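/- Let $\mathbb{K}$ be an algebraically closed field of characteristic zero. An affine toric variety is a normal irreducible affine algebraic variety $X$ over $\mathbb{K}$ that contains an algebraic torus $T=(\mathbb{K}^{\times})^n$ as a dense open subset such that the action of $T$ on itself by multiplication extends to a regular action of $T$ on $X$. It is called degenerate if there is a non-constant invertible regular function on $X$ (equivalently, if $X\cong Y\times(\mathbb{K}^{\times})^q$ for some toric variety $Y$ and some $q\ge 1$). The group $\mathrm{Aut}(X)$ of regular automorphisms of $X$ is called connected if for every $g\in\mathrm{Aut}(X)$ there are an irreducible affine algebraic variety $S$ and a family $\{\phi_s\}_{s\in S}$ in $\mathrm{Aut}(X)$ containing both $g$ and the identity automorphism, such that the map $S\times X\to X$, $(s,x)\mapsto\phi_s(x)$, is a morphism of algebraic varieties. If $X$ is a degenerate affine toric variety with acting torus $T$, then the group $\mathrm{Aut}(X)$ is not connected. -/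

import Mathlib

open CategoryTheory AlgebraicGeometry MonoidalCategory CartesianMonoidalCategory

namespace AffineToric

universe u

noncomputable section

variable {K : Type u} [Field K]

/-- An irreducible algebraic variety over `K`: an integral separated scheme of finite type
over `Spec K`. -/
structure IsVariety (X : Over (Spec (.of K))) : Prop where
  isIntegral : IsIntegral X.left
  isSeparated : IsSeparated X.hom
  locallyOfFiniteType : LocallyOfFiniteType X.hom
  quasiCompact : QuasiCompact X.hom

/-- `X` is normal: all its local rings are integrally closed (they are domains when `X` is
integral). -/
def IsNormalScheme (X : Scheme.{u}) : Prop :=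
  ∀ x : X, IsIntegrallyClosed (X.presheaf.stalk x)

variable (K) in
/-- The algebraic torus `(Kˣ)ⁿ`, as the spectrum of the Laurent polynomial algebra `K[ℤⁿ]`.
Its group structure is the one induced by the Hopf algebra structure of `K[ℤⁿ]`, in which every
monomial is group-like. -/
abbrev torus (n : ℕ) : Over (Spec (.of K)) :=
  (Spec (.of (AddMonoidAlgebra K (Fin n → ℤ)))).asOver (Spec (.of K))

/-- A toric variety with acting torus `(Kˣ)ⁿ`: a normal irreducible variety `X` with an embedding
of the torus as a dense open subset, and a regular action of the torus on `X` that extends the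
action of the torus on itself by multiplication. -/
structure ToricStructure (n : ℕ) (X : Over (Spec (.of K))) where
  isVariety : IsVariety X
  isNormal : IsNormalScheme X.left
  /-- The inclusion of the torus. -/
  incl : torus K n ⟶ X
  isOpenImmersion : IsOpenImmersion incl.left
  isDominant : IsDominant incl.left
  /-- The action of the torus. -/
  act : torus K n ⊗ X ⟶ X
  one_act : (MonObj.one (X := torus K n) ▷ X) ≫ act = (λ_ X).hom
  mul_act : (MonObj.mul (X := torus K n) ▷ X) ≫ act =
    (α_ (torus K n) (torus K n) X).hom ≫ (torus K n ◁ act) ≫ act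
  act_incl : (torus K n ◁ incl) ≫ act = MonObj.mul (X := torus K n) ≫ incl

/-- `X` is non-degenerate: every invertible regular function on `X` is constant. -/
def IsNondegenerate (X : Over (Spec (.of K))) : Prop :=
  ∀ f : X.left.presheaf.obj (.op ⊤), IsUnit f →
    ∃ c : K, X.hom.appTop ((Scheme.ΓSpecIso (.of K)).inv c) = f

/-- The `K`-points of `X` (for `K` algebraically closed and `X` a variety, these are the points
of `X` in the classical sense). -/
abbrev Pt (X : Over (Spec (.of K))) := 𝟙_ (Over (Spec (.of K))) ⟶ X

/-- The family `φ` of automorphisms of `X`, parameterized by the points of `S`, is algebraic: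
the map `(s, x) ↦ φ_s(x)` is a morphism `S × X ⟶ X`. -/
def IsAlgebraicFamily {S X : Over (Spec (.of K))} (φ : Pt S → Aut X) : Prop :=
  ∃ F : S ⊗ X ⟶ X, ∀ (s : Pt S) (x : Pt X), lift s x ≫ F = x ≫ (φ s).hom

/-- A subgroup `G` of `Aut(X)` is connected: every `g ∈ G` lies, together with the identity, in an
algebraic family of elements of `G` that is parameterized by an irreducible affine variety. -/
def IsConnectedSubgroup {X : Over (Spec (.of K))} (G : Subgroup (Aut X)) : Prop :=
  ∀ g ∈ G, ∃ (S : Over (Spec (.of K))) (φ : Pt S → Aut X),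
    IsVariety S ∧ IsAffine S.left ∧ IsAlgebraicFamily φ ∧ (∀ s, φ s ∈ G) ∧
      (∃ s, φ s = g) ∧ (∃ s, φ s = 1)

end

end AffineToric

/-! Units on the torus are monomials, so a non-constant unit of `X` restricts to a scalar times a
character with nonzero exponent `d • l`, `l` primitive. By normality the characters of exponents `l`
and `-l` extend to `X`, giving a unit `h` (`ToricStructure.exists_isUnit_pull_eq_character`). For a
one-parameter subgroup `v` dual to `l`, the automorphism `x ↦ v (h x)⁻² • x` inverts `h`
(`ToricStructure.exists_aut_inv`). An irreducible family cannot join it to the identity: pulled back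
to `S × T`, `h` is a unit of Laurent polynomials over the domain `Γ(S)`, hence a single monomial,
whose exponent does not depend on `s` (`exists_pull_lift_eq_mul_character`). Comparing the two
members at `1 ∈ T` forces the characters `l` and `-l` to agree on `K`-points, which fails in
characteristic zero. -/

namespace AddMonoidAlgebra

/-! ### Units of Laurent polynomial rings -/

/-- Over a domain, the units of the monoid algebra of a monoid with two unique sums are
monomials. -/
theorem exists_single_eq_of_isUnit {R M : Type*} [CommRing R] [IsDomain R] [AddCommGroup M]
    [TwoUniqueSums M] {f : AddMonoidAlgebra R M} (hf : IsUnit f) :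
    ∃ m b, b ≠ 0 ∧ f = single m b := by
  obtain ⟨g, hg⟩ := hf.exists_right_inv
  have hf0 : f.coeff.support.Nonempty := by
    rw [Finsupp.support_nonempty_iff, ne_eq, coeff_eq_zero]
    rintro rfl
    simp at hg
  have hg0 : g.coeff.support.Nonempty := by
    rw [Finsupp.support_nonempty_iff, ne_eq, coeff_eq_zero]
    rintro rfl
    simp at hg
  classical
  -- At a uniquely represented sum, the coefficient of `f * g = 1` is a product of nonzero
  -- coefficients, so the sum is `0`; two such pairs would then contradict uniqueness.
  have key : ∀ p ∈ f.coeff.support ×ˢ g.coeff.support,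
      UniqueAdd f.coeff.support g.coeff.support p.1 p.2 → p.1 + p.2 = 0 := by
    intro p hp h
    have h1 := coeff_mul_add_of_uniqueAdd h
    rw [Finset.mem_product, Finsupp.mem_support_iff, Finsupp.mem_support_iff] at hp
    by_contra hne
    have h2 : f.coeff p.1 * g.coeff p.2 ≠ 0 := mul_ne_zero hp.1 hp.2
    rw [← h1, hg, one_def, coeff_single, Finsupp.single_apply, if_neg (Ne.symm hne)] at h2
    exact h2 rfl
  have hcard : ¬ 1 < f.coeff.support.card * g.coeff.support.card := by
    intro h
    obtain ⟨p, hp, q, hq, hne, hup, huq⟩ := TwoUniqueSums.uniqueAdd_of_one_lt_card h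
    have h0 := (key p hp hup).trans (key q hq huq).symm
    rw [Finset.mem_product] at hp hq
    have := hup hq.1 hq.2 h0.symm
    exact hne (Prod.ext this.1.symm this.2.symm)
  have h1 : f.coeff.support.card = 1 := by
    have := hf0.card_pos
    have := hg0.card_pos
    nlinarith
  obtain ⟨m, b, hb, h⟩ := Finsupp.card_support_eq_one'.mp h1
  exact ⟨m, b, hb, by rw [← coeff_inj, h, coeff_single]⟩

end AddMonoidAlgebra

/-! ### Global functions, and morphisms to affine schemes and tori -/

namespace AffineToric

universe u

noncomputable section

variable {K : Type u} [Field K]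

/-- Pullback of global functions along a morphism of `K`-schemes. -/
def pull {W Y : Over (Spec (.of K))} (f : W ⟶ Y) : Γ(Y.left, ⊤) →+* Γ(W.left, ⊤) :=
  f.left.appTop.hom

/-- The constant functions on a `K`-scheme. -/
def scalar (Y : Over (Spec (.of K))) : K →+* Γ(Y.left, ⊤) :=
  ((Scheme.ΓSpecIso (.of K)).inv ≫ Y.hom.appTop).hom

theorem pull_comp {V W Y : Over (Spec (.of K))} (f : V ⟶ W) (g : W ⟶ Y) :
    pull (f ≫ g) = (pull f).comp (pull g) := by
  rw [pull, Over.comp_left, Scheme.Hom.comp_appTop, CommRingCat.hom_comp]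
  rfl

theorem pull_comp_apply {V W Y : Over (Spec (.of K))} (f : V ⟶ W) (g : W ⟶ Y)
    (y : Γ(Y.left, ⊤)) : pull (f ≫ g) y = pull f (pull g y) := by
  rw [pull_comp, RingHom.comp_apply]

theorem pull_id_apply {Y : Over (Spec (.of K))} (y : Γ(Y.left, ⊤)) : pull (𝟙 Y) y = y := by
  simp [pull]

theorem pull_scalar {W Y : Over (Spec (.of K))} (f : W ⟶ Y) (c : K) :
    pull f (scalar Y c) = scalar W c := by
  rw [← RingHom.comp_apply]
  congr 1
  rw [pull, scalar, scalar, ← CommRingCat.hom_comp, Category.assoc, ← Scheme.Hom.comp_appTop,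
    Over.w]

theorem hom_ext_of_pull {W Y : Over (Spec (.of K))} [IsAffine Y.left] {f g : W ⟶ Y}
    (h : ∀ y, pull f y = pull g y) : f = g := by
  ext1
  refine ext_of_isAffine ?_
  ext y
  exact h y

theorem exists_hom_of_ringHom {W Y : Over (Spec (.of K))} [IsAffine Y.left]
    (φ : Γ(Y.left, ⊤) →+* Γ(W.left, ⊤)) (h : ∀ c, φ (scalar Y c) = scalar W c) :
    ∃ f : W ⟶ Y, pull f = φ := by
  let f : W.left ⟶ Y.left :=
    W.left.toSpecΓ ≫ Spec.map (CommRingCat.ofHom φ) ≫ Y.left.isoSpec.inv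
  have hf : f.appTop = CommRingCat.ofHom φ := by
    have h1 : f ≫ Y.left.toSpecΓ = W.left.toSpecΓ ≫ Spec.map (CommRingCat.ofHom φ) := by
      simp [f, Scheme.isoSpec]
    have h2 := congrArg (fun k => (Scheme.ΓSpecIso _).inv ≫ k.appTop) h1
    simp only [Scheme.Hom.comp_appTop, Scheme.toSpecΓ_appTop,
      ← Scheme.ΓSpecIso_inv_naturality_assoc, Iso.inv_hom_id_assoc, Iso.inv_hom_id,
      Category.comp_id] at h2
    exact h2
  have hw : f ≫ Y.hom = W.hom := by
    refine ext_of_isAffine ?_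
    rw [Scheme.Hom.comp_appTop, hf, ← cancel_epi (Scheme.ΓSpecIso (.of K)).inv]
    ext c
    exact h c
  exact ⟨Over.homMk f hw, by simp [pull, hf]⟩

/-- The spectrum of a `K`-algebra as a `K`-scheme. -/
abbrev specOver {R : Type u} [CommRing R] (σ : K →+* R) : Over (Spec (.of K)) :=
  Over.mk (Spec.map (CommRingCat.ofHom σ))

/-- The ring of global functions on the spectrum of a `K`-algebra. -/
def specOverEquiv {R : Type u} [CommRing R] (σ : K →+* R) : R ≃+* Γ((specOver σ).left, ⊤) :=
  (Scheme.ΓSpecIso (.of R)).symm.commRingCatIsoToRingEquiv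

theorem specOverEquiv_scalar {R : Type u} [CommRing R] (σ : K →+* R) (c : K) :
    specOverEquiv σ (σ c) = scalar (specOver σ) c := by
  have := congr($(Scheme.ΓSpecIso_inv_naturality (CommRingCat.ofHom σ)).hom c)
  exact this

variable (K) in
/-- The ring of global functions on the torus is the ring of Laurent polynomials. -/
def torusEquiv (n : ℕ) : AddMonoidAlgebra K (Fin n → ℤ) ≃+* Γ((torus K n).left, ⊤) :=
  specOverEquiv (algebraMap K (AddMonoidAlgebra K (Fin n → ℤ)))

theorem torusEquiv_algebraMap {n : ℕ} (c : K) :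
    torusEquiv K n (algebraMap K _ c) = scalar (torus K n) c :=
  specOverEquiv_scalar _ c

variable (K) in
/-- The character of the torus with exponent `m`. -/
def character {n : ℕ} (m : Fin n → ℤ) : Γ((torus K n).left, ⊤) :=
  torusEquiv K n (AddMonoidAlgebra.single m 1)

theorem character_zero {n : ℕ} : character K (0 : Fin n → ℤ) = 1 :=
  map_one (torusEquiv K n)

theorem character_add {n : ℕ} (m m' : Fin n → ℤ) :
    character K (m + m') = character K m * character K m' := by
  rw [character, character, character, ← map_mul, AddMonoidAlgebra.single_mul_single, mul_one]

theorem torusEquiv_single {n : ℕ} (m : Fin n → ℤ) (c : K) :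
    torusEquiv K n (AddMonoidAlgebra.single m c) = scalar (torus K n) c * character K m := by
  have h : AddMonoidAlgebra.single m c =
      algebraMap K (AddMonoidAlgebra K (Fin n → ℤ)) c * AddMonoidAlgebra.single m 1 := by
    simp [AddMonoidAlgebra.single_mul_single]
  rw [h, map_mul, torusEquiv_algebraMap, character]

theorem ringHom_ext_of_character {n : ℕ} {R : Type*} [CommRing R]
    {φ ψ : Γ((torus K n).left, ⊤) →+* R}
    (h : ∀ c, φ (scalar (torus K n) c) = ψ (scalar (torus K n) c))
    (h' : ∀ m, φ (character K m) = ψ (character K m)) : φ = ψ := by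
  have : φ.comp (torusEquiv K n).toRingHom = ψ.comp (torusEquiv K n).toRingHom := by
    refine AddMonoidAlgebra.ringHom_ext (fun c => ?_) (fun m => h' m)
    change φ (torusEquiv K n _) = ψ (torusEquiv K n _)
    rw [torusEquiv_single, map_mul, map_mul, h, h']
  ext y
  obtain ⟨x, rfl⟩ := (torusEquiv K n).surjective y
  exact congr($this x)

instance {n : ℕ} : IsAffine (torus K n).left := inferInstanceAs (IsAffine (Spec _))

theorem exists_hom_torus {n : ℕ} {W : Over (Spec (.of K))}
    (χ : Multiplicative (Fin n → ℤ) →* Γ(W.left, ⊤)) :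
    ∃ f : W ⟶ torus K n, ∀ m, pull f (character K m) = χ (.ofAdd m) := by
  let φ : AddMonoidAlgebra K (Fin n → ℤ) →+* Γ(W.left, ⊤) :=
    AddMonoidAlgebra.liftNCRingHom (scalar W) χ fun _ _ => Commute.all _ _
  have hφ (m c) : φ (AddMonoidAlgebra.single m c) = scalar W c * χ (.ofAdd m) :=
    AddMonoidAlgebra.liftNCRingHom_single ..
  obtain ⟨f, hf⟩ := exists_hom_of_ringHom (W := W) (Y := torus K n)
    (φ.comp (torusEquiv K n).symm.toRingHom) fun c => by
      change φ ((torusEquiv K n).symm _) = _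
      rw [← torusEquiv_algebraMap, RingEquiv.symm_apply_apply]
      refine (hφ 0 c).trans ?_
      rw [ofAdd_zero, map_one, mul_one]
  refine ⟨f, fun m => ?_⟩
  rw [hf, character]
  change φ ((torusEquiv K n).symm (torusEquiv K n _)) = _
  rw [RingEquiv.symm_apply_apply, hφ, map_one, one_mul]

theorem pull_torusEquiv_of_factor {n : ℕ} {W : Over (Spec (.of K))} {B : Type u} [CommRing B]
    (f : W ⟶ torus K n) (p : W.left ⟶ Spec (.of B)) (φ : AddMonoidAlgebra K (Fin n → ℤ) →+* B)
    (h : f.left = p ≫ Spec.map (CommRingCat.ofHom φ)) (a : AddMonoidAlgebra K (Fin n → ℤ)) :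
    pull f (torusEquiv K n a) = p.appTop.hom ((Scheme.ΓSpecIso (.of B)).inv.hom (φ a)) := by
  let A := AddMonoidAlgebra K (Fin n → ℤ)
  have h1 := congrArg (fun k : W.left ⟶ Spec (.of A) =>
    k.appTop.hom ((Scheme.ΓSpecIso (.of A)).inv.hom a)) h
  refine h1.trans ?_
  simp only [Scheme.Hom.comp_appTop, CommRingCat.hom_comp, RingHom.comp_apply]
  exact congrArg p.appTop.hom
    congr($(Scheme.ΓSpecIso_inv_naturality (CommRingCat.ofHom φ)).hom a).symm

/-- Monomials are group-like, and `pullbackSpecIso` turns the comultiplication into the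
multiplication of the torus. -/
theorem pull_mul_character {n : ℕ} (m : Fin n → ℤ) :
    pull (MonObj.mul (X := torus K n)) (character K m) =
      pull (fst (torus K n) (torus K n)) (character K m) *
        pull (snd (torus K n) (torus K n)) (character K m) := by
  let A := AddMonoidAlgebra K (Fin n → ℤ)
  let p : (torus K n ⊗ torus K n).left ⟶ Spec (.of (TensorProduct K A A)) :=
    (pullbackSpecIso K A A).hom
  let l : A →+* TensorProduct K A A := Algebra.TensorProduct.includeLeftRingHom
  let r : A →+* TensorProduct K A A := Algebra.TensorProduct.includeRight.toRingHom
  have h : Bialgebra.comulAlgHom K A (AddMonoidAlgebra.single m 1) =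
      l (AddMonoidAlgebra.single m 1) * r (AddMonoidAlgebra.single m 1) := by
    refine (AddMonoidAlgebra.comul_single m (1 : K)).trans ?_
    simp [l, r]
  rw [character,
    pull_torusEquiv_of_factor _ p (Bialgebra.comulAlgHom K A).toRingHom mul_spec_asOver_spec_left,
    pull_torusEquiv_of_factor _ p l (pullbackSpecIso_hom_fst ..).symm,
    pull_torusEquiv_of_factor _ p r (pullbackSpecIso_hom_snd ..).symm, ← map_mul, ← map_mul]
  exact congrArg _ (congrArg _ h)

theorem pull_lift_mul_character {n : ℕ} {W : Over (Spec (.of K))} (a b : W ⟶ torus K n)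
    (m : Fin n → ℤ) :
    pull (lift a b ≫ MonObj.mul (X := torus K n)) (character K m) =
      pull a (character K m) * pull b (character K m) := by
  rw [pull_comp_apply, pull_mul_character, map_mul, ← pull_comp_apply, ← pull_comp_apply,
    lift_fst, lift_snd]

end
end AffineToric

/-! ### Extending functions from open subschemes by normality -/

namespace AlgebraicGeometry

theorem appTop_injective_of_isOpenImmersion {U X : Scheme} (i : U ⟶ X) [IsOpenImmersion i]
    [IsIntegral X] [Nonempty U] : Function.Injective i.appTop := by
  obtain ⟨x⟩ := ‹Nonempty U›
  have h := i.germ_stalkMap ⊤ x trivial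
  have hinj : Function.Injective (i.stalkMap x) :=
    (ConcreteCategory.bijective_of_isIso (i.stalkMap x)).1
  intro a b hab
  refine germ_injective_of_isIntegral X (i x) (U := ⊤) trivial (hinj ?_)
  have (c : Γ(X, ⊤)) : i.stalkMap x (X.presheaf.germ ⊤ (i x) trivial c) =
      U.presheaf.germ ⊤ x trivial (i.appTop c) := congr($h c)
  rw [this, this, hab]

/-- A function on an open subscheme of an affine scheme is a quotient of global functions. -/
theorem exists_appTop_mul_eq_of_isOpenImmersion {U X : Scheme} (i : U ⟶ X) [IsOpenImmersion i]
    [IsIntegral U] [IsAffine X] (y : Γ(U, ⊤)) :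
    ∃ a b : Γ(X, ⊤), b ≠ 0 ∧ i.appTop b * y = i.appTop a := by
  obtain ⟨x⟩ : Nonempty U := inferInstance
  have h := i.germ_stalkMap ⊤ x trivial
  have h (c : Γ(X, ⊤)) : i.stalkMap x (X.presheaf.germ ⊤ (i x) trivial c) =
      U.presheaf.germ ⊤ x trivial (i.appTop c) := congr($h c)
  obtain ⟨z, hz⟩ := (ConcreteCategory.bijective_of_isIso (i.stalkMap x)).2
    (U.presheaf.germ ⊤ x trivial y)
  let ix : (⊤ : X.Opens) := ⟨i x, trivial⟩
  have hloc := (isAffineOpen_top X).isLocalization_stalk ix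
  let := TopCat.Presheaf.algebra_section_stalk X.presheaf ix
  obtain ⟨⟨a, b⟩, hab⟩ :=
    IsLocalization.surj ((isAffineOpen_top X).primeIdealOf ix).asIdeal.primeCompl z
  have hb : (b : Γ(X, ⊤)) ≠ 0 := fun h0 => b.2 (h0 ▸ zero_mem _)
  refine ⟨a, b, hb, germ_injective_of_isIntegral U x (U := ⊤) trivial ?_⟩
  rw [map_mul, ← h, ← h, ← hz, ← map_mul, mul_comm]
  exact congrArg _ hab

/-- Integral closedness can be tested at maximal ideals, where the localizations are stalks. -/
theorem isIntegrallyClosed_Γ_of_stalk {X : Scheme} [IsIntegral X] [IsAffine X]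
    (h : ∀ x : X, IsIntegrallyClosed (X.presheaf.stalk x)) : IsIntegrallyClosed Γ(X, ⊤) := by
  let hU := isAffineOpen_top X
  refine .of_localization_maximal fun P _ hP => ?_
  let x : PrimeSpectrum Γ(X, ⊤) := ⟨P, hP.isPrime⟩
  let := TopCat.Presheaf.algebra_section_stalk X.presheaf (U := ⊤) ⟨hU.fromSpec x, trivial⟩
  have : IsLocalization P.primeCompl (X.presheaf.stalk (hU.fromSpec x)) :=
    hU.isLocalization_stalk' x trivial
  have := h (hU.fromSpec x)
  exact .of_equiv (IsLocalization.algEquiv P.primeCompl (X.presheaf.stalk (hU.fromSpec x))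
    (Localization.AtPrime P)).toRingEquiv

/-- On a normal affine variety, a function on an open subscheme extends if one of its powers
does. -/
theorem mem_range_appTop_of_pow_mem {U X : Scheme} (i : U ⟶ X) [IsOpenImmersion i]
    [IsIntegral U] [IsIntegral X] [IsAffine X]
    (h : ∀ x : X, IsIntegrallyClosed (X.presheaf.stalk x)) {y : Γ(U, ⊤)} {d : ℕ} (hd : d ≠ 0)
    (hy : ∃ c, i.appTop c = y ^ d) : ∃ c, i.appTop c = y := by
  have := isIntegrallyClosed_Γ_of_stalk h
  have hinj := appTop_injective_of_isOpenImmersion i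
  obtain ⟨a, b, hb, hab⟩ := exists_appTop_mul_eq_of_isOpenImmersion i y
  obtain ⟨c, hc⟩ := hy
  -- With `y = a / b`, the extension of `y ^ d` says `b ^ d ∣ a ^ d`; integral closedness yields `b
  -- ∣ a`.
  have hdvd : b ^ d ∣ a ^ d := ⟨c, hinj (by rw [map_mul, map_pow, map_pow, hc, ← hab, mul_pow])⟩
  obtain ⟨e, rfl⟩ := (IsIntegrallyClosed.pow_dvd_pow_iff hd).mp hdvd
  refine ⟨e, mul_left_cancel₀ ((map_ne_zero_iff _ hinj).mpr hb) ?_⟩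
  rw [hab, map_mul]

end AlgebraicGeometry

/-! ### Primitive vectors -/

/-- A nonzero integer vector is a positive multiple of a primitive one. -/
theorem exists_nsmul_eq_of_ne_zero {n : ℕ} {l : Fin n → ℤ} (hl : l ≠ 0) :
    ∃ (d : ℕ) (l' : Fin n → ℤ) (u : (Fin n → ℤ) →+ ℤ), d ≠ 0 ∧ l = d • l' ∧ u l' = 1 := by
  obtain ⟨i, hi⟩ := Function.ne_iff.mp hl
  obtain ⟨g, hg, hg1⟩ := Finset.extract_gcd l (s := Finset.univ) ⟨i, Finset.mem_univ i⟩
  -- The Bézout coefficients `c` of the primitive vector `g` define the dual functional.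
  obtain ⟨c, hc⟩ := Finset.gcd_eq_sum_mul Finset.univ g
  rw [hg1] at hc
  set D := Finset.univ.gcd l
  have hD : 0 ≤ D := Int.nonneg_of_normalize_eq_self Finset.normalize_gcd
  have hD0 : D ≠ 0 := fun h => hi (by simp [hg i (Finset.mem_univ i), h])
  refine ⟨D.natAbs, g, ∑ j, (AddMonoidHom.mulRight (c j)).comp (Pi.evalAddMonoidHom _ j),
    Int.natAbs_ne_zero.mpr hD0, ?_, ?_⟩
  · ext j
    rw [hg j (Finset.mem_univ j), Pi.smul_apply, nsmul_eq_mul, Int.natAbs_of_nonneg hD]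
  · simp [hc]

/-! ### Units in families, and the involution -/

namespace AffineToric

universe u

noncomputable section

variable {K : Type u} [Field K]

variable (K) in
/-- The monoid homomorphism sending an exponent to the corresponding character. -/
def characterHom (n : ℕ) : Multiplicative (Fin n → ℤ) →* Γ((torus K n).left, ⊤) where
  toFun m := character K m.toAdd
  map_one' := character_zero
  map_mul' m m' := character_add m.toAdd m'.toAdd

/-- A unit pulled back to the product of an affine variety and a torus is a function on the
variety times a character. -/
theorem exists_pull_lift_eq_mul_character {n : ℕ} {S X : Over (Spec (.of K))} [IsAffine S.left]
    [IsIntegral S.left] (i : torus K n ⟶ X) (F : S ⊗ X ⟶ X) {h : Γ(X.left, ⊤)} (hu : IsUnit h) :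
    ∃ (m : Fin n → ℤ) (b : Γ(S.left, ⊤)), ∀ {W : Over (Spec (.of K))} (s : W ⟶ S)
      (t : W ⟶ torus K n), pull (lift s (t ≫ i) ≫ F) h = pull s b * pull t (character K m) := by
  let B := Γ(S.left, ⊤)
  -- The spectrum of `Γ(S)[ℤⁿ]` stands in for `S × T`; only its projections `p`, `q` and the induced
  -- maps `z` into it are needed.
  let σ : K →+* AddMonoidAlgebra B (Fin n → ℤ) :=
    (AddMonoidAlgebra.singleZeroRingHom).comp (scalar S)
  let e := specOverEquiv σ
  obtain ⟨p, hp⟩ := exists_hom_of_ringHom (W := specOver σ) (Y := S)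
    (e.toRingHom.comp AddMonoidAlgebra.singleZeroRingHom) fun c => specOverEquiv_scalar σ c
  obtain ⟨q, hq⟩ := exists_hom_torus (W := specOver σ)
    ((e : _ →* _).comp (AddMonoidAlgebra.of B (Fin n → ℤ)))
  obtain ⟨m, b, -, hmb⟩ := AddMonoidAlgebra.exists_single_eq_of_isUnit
    ((hu.map (pull (lift p (q ≫ i) ≫ F))).map e.symm)
  refine ⟨m, b, fun {W} s t => ?_⟩
  let φ : AddMonoidAlgebra B (Fin n → ℤ) →+* Γ(W.left, ⊤) :=
    AddMonoidAlgebra.liftNCRingHom (pull s) (((pull t) : _ →* _).comp (characterHom K n))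
      fun _ _ => Commute.all _ _
  have hφ (k c) : φ (AddMonoidAlgebra.single k c) = pull s c * pull t (character K k) :=
    AddMonoidAlgebra.liftNCRingHom_single ..
  have hφ0 (c) : φ (AddMonoidAlgebra.single 0 c) = pull s c := by
    rw [hφ, character_zero, map_one, mul_one]
  have : IsAffine (specOver σ).left := inferInstanceAs (IsAffine (Spec _))
  obtain ⟨z, hz⟩ := exists_hom_of_ringHom (W := W) (Y := specOver σ)
    (φ.comp e.symm.toRingHom) fun c => by
      rw [← specOverEquiv_scalar σ c]
      change φ (e.symm (e _)) = _
      rw [e.symm_apply_apply]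
      exact (hφ0 _).trans (pull_scalar s c)
  have hze (x) : pull z (e x) = φ x := by
    rw [hz]
    change φ (e.symm (e _)) = _
    rw [e.symm_apply_apply]
  have hzp : z ≫ p = s := hom_ext_of_pull fun c => by
    rw [pull_comp_apply, hp]
    exact (hze _).trans (hφ0 c)
  have hzq : z ≫ q = t := by
    have : pull (z ≫ q) = pull t := by
      refine ringHom_ext_of_character (fun c => ?_) (fun k => ?_)
      · rw [pull_scalar, pull_scalar]
      · rw [pull_comp_apply, hq]
        refine (hze _).trans ((hφ k 1).trans ?_)
        rw [map_one, one_mul]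
    exact hom_ext_of_pull fun y => congr($this y)
  have hfac : lift s (t ≫ i) ≫ F = z ≫ lift p (q ≫ i) ≫ F := by
    rw [← Category.assoc, comp_lift, hzp, ← Category.assoc, hzq]
  rw [hfac, pull_comp_apply, ← hφ, ← hmb, ← hze, e.apply_symm_apply]

/-- A degenerate affine toric variety has an invertible function which restricts to a primitive
character of the torus. -/
theorem ToricStructure.exists_isUnit_pull_eq_character {n : ℕ} {X : Over (Spec (.of K))}
    [IsAffine X.left] (hT : ToricStructure n X) (hdeg : ¬ IsNondegenerate X) :
    ∃ (l : Fin n → ℤ) (v : (Fin n → ℤ) →+ ℤ) (h : Γ(X.left, ⊤)ˣ),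
      v l = 1 ∧ pull hT.incl h = character K l := by
  have := hT.isVariety.isIntegral
  have := hT.isOpenImmersion
  have hdom : IsIntegral (torus K n).left :=
    inferInstanceAs (IsIntegral (Spec (.of (AddMonoidAlgebra K (Fin n → ℤ)))))
  have hinj : Function.Injective (pull hT.incl) :=
    appTop_injective_of_isOpenImmersion hT.incl.left
  rw [IsNondegenerate] at hdeg
  push Not at hdeg
  obtain ⟨f, hf, hfc⟩ := hdeg
  have hmon {g : Γ(X.left, ⊤)} (hg : IsUnit g) :
      ∃ m c, c ≠ 0 ∧ pull hT.incl g = scalar (torus K n) c * character K m := by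
    obtain ⟨m, c, hc, h⟩ := AddMonoidAlgebra.exists_single_eq_of_isUnit
      ((hg.map (pull hT.incl)).map (torusEquiv K n).symm)
    refine ⟨m, c, hc, ?_⟩
    rw [← torusEquiv_single, ← h, RingEquiv.apply_symm_apply]
  obtain ⟨m, c, hc, hm⟩ := hmon hf
  have hm0 : m ≠ 0 := by
    rintro rfl
    refine hfc c (hinj ?_)
    rw [hm, character_zero, mul_one]
    exact pull_scalar hT.incl c
  obtain ⟨d, l, v, hd, rfl, hv⟩ := exists_nsmul_eq_of_ne_zero hm0
  have hpow (k : Fin n → ℤ) : character K (d • k) = character K k ^ d :=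
    map_pow (characterHom K n) (.ofAdd k) d
  have hsc : scalar (torus K n) c⁻¹ * scalar (torus K n) c = 1 := by
    rw [← map_mul, inv_mul_cancel₀ hc, map_one]
  have hneg : character K l * character K (-l) = 1 := by
    rw [← character_add, add_neg_cancel, character_zero]
  obtain ⟨h₁, hh₁⟩ := mem_range_appTop_of_pow_mem hT.incl.left hT.isNormal (y := character K l) hd
    ⟨scalar X c⁻¹ * f, by
      change pull hT.incl _ = _
      rw [map_mul, hm, pull_scalar, ← mul_assoc, hsc, one_mul, hpow]⟩
  obtain ⟨f', hf'⟩ := hf.exists_right_inv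
  have hff' : pull hT.incl f' * pull hT.incl f = 1 := by
    rw [← map_mul, mul_comm, hf', map_one]
  obtain ⟨h₂, hh₂⟩ := mem_range_appTop_of_pow_mem hT.incl.left hT.isNormal
    (y := character K (-l)) hd
    ⟨scalar X c * f', by
      change pull hT.incl _ = _
      calc pull hT.incl (scalar X c * f')
          = scalar (torus K n) c * pull hT.incl f' * (character K l * character K (-l)) ^ d := by
            rw [hneg, one_pow, mul_one, map_mul, pull_scalar]
        _ = pull hT.incl f' * pull hT.incl f * character K (-l) ^ d := by
            rw [hm, hpow]
            ring
        _ = _ := by rw [hff', one_mul]⟩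
  have h12 : h₁ * h₂ = 1 := hinj (by
    rw [map_mul, map_one, ← hneg]
    exact congrArg₂ (· * ·) hh₁ hh₂)
  exact ⟨l, v, ⟨h₁, h₂, h12, by rw [mul_comm, h12]⟩, hv, hh₁⟩

/-- A toric variety with an invertible function `h` restricting to a character `χ` of the torus
and a one-parameter subgroup `v` with `χ (v t) = t` has an involution which maps `h` to `h⁻¹`:
it is `x ↦ v (h x)⁻² • x`. -/
theorem ToricStructure.exists_aut_inv {n : ℕ} {X : Over (Spec (.of K))} [IsAffine X.left]
    (hT : ToricStructure n X) {l : Fin n → ℤ} {v : (Fin n → ℤ) →+ ℤ} {h : Γ(X.left, ⊤)ˣ}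
    (hv : v l = 1) (hl : pull hT.incl h = character K l) :
    ∃ g : Aut X, pull (hT.incl ≫ g.hom) h = character K (-l) := by
  have := hT.isVariety.isIntegral
  have := hT.isVariety.isSeparated
  have := hT.isDominant
  -- The exponent `-2` is chosen so that `l` goes to `l - 2 • l = -l`, since `v l = 1`.
  let χ : Multiplicative (Fin n → ℤ) →* Γ(X.left, ⊤)ˣ :=
    (zpowersHom _ h).comp (((-2 : ℤ) • v).toMultiplicative)
  have hχ (m) : χ (.ofAdd m) = h ^ (-2 * v m) := rfl
  have hpz (k : ℤ) : pull hT.incl (h ^ k : Γ(X.left, ⊤)ˣ) = character K (k • l) := by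
    let E : Multiplicative ℤ →* Γ((torus K n).left, ⊤) :=
      ((pull hT.incl : _ →* _).comp (Units.coeHom _)).comp (zpowersHom _ h)
    let E' : Multiplicative ℤ →* Γ((torus K n).left, ⊤) :=
      (characterHom K n).comp (zpowersHom _ (Multiplicative.ofAdd l))
    have : E = E' := by
      ext
      simp [E, E', hl, characterHom]
    exact congr($this (.ofAdd k))
  obtain ⟨τ, hτ⟩ := exists_hom_torus (W := X) ((Units.coeHom _).comp χ)
  let g : X ⟶ X := lift τ (𝟙 X) ≫ hT.act
  let γ : torus K n ⟶ torus K n := lift (hT.incl ≫ τ) (𝟙 _) ≫ MonObj.mul (X := torus K n)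
  have hg : hT.incl ≫ g = γ ≫ hT.incl := by
    have : hT.incl ≫ lift τ (𝟙 X) = lift (hT.incl ≫ τ) (𝟙 _) ≫ (torus K n ◁ hT.incl) := by
      ext1 <;> simp
    rw [← Category.assoc, this, Category.assoc, hT.act_incl, Category.assoc]
  have hγ (m) : pull γ (character K m) = character K (m - (2 * v m) • l) := by
    rw [pull_lift_mul_character, pull_id_apply, pull_comp_apply, hτ]
    change pull hT.incl (χ (.ofAdd m) : Γ(X.left, ⊤)ˣ) * _ = _
    rw [hχ, hpz, ← character_add]
    congr 1
    rw [neg_mul, neg_smul, neg_add_eq_sub]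
  have hγγ : γ ≫ γ = 𝟙 _ := by
    have : pull (γ ≫ γ) = pull (𝟙 _) := by
      refine ringHom_ext_of_character (fun c => ?_) (fun m => ?_)
      · rw [pull_scalar, pull_scalar]
      · rw [pull_comp_apply, pull_id_apply, hγ, hγ, map_sub, map_zsmul, hv]
        congr 1
        module
    exact hom_ext_of_pull fun y => congr($this y)
  -- The identity holds on the dense torus and `X` is separated.
  have hgg : g ≫ g = 𝟙 X := by
    have h1 : hT.incl ≫ g ≫ g = hT.incl ≫ 𝟙 X := by
      rw [← Category.assoc, hg, Category.assoc, hg, ← Category.assoc, hγγ, Category.id_comp,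
        Category.comp_id]
    ext1
    exact ext_of_isDominant_of_isSeparated X.hom (by simp only [Over.w]) hT.incl.left
      congr(($h1).left)
  refine ⟨⟨g, g, hgg, hgg⟩, ?_⟩
  change pull (hT.incl ≫ g) _ = _
  rw [hg, pull_comp_apply, hl, hγ, hv]
  congr 1
  module

/-- In characteristic zero, a nonzero exponent gives a character which is not trivial on the
`K`-points of the torus. -/
theorem exists_pt_pull_character_ne_one [CharZero K] {n : ℕ} {l : Fin n → ℤ} (hl : l ≠ 0) :
    ∃ t : Pt (torus K n), pull t (character K l) ≠ 1 := by
  obtain ⟨i, hi⟩ := Function.ne_iff.mp hl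
  -- This is the point with `i`-th coordinate `2` and all others `1`.
  let χ : Multiplicative (Fin n → ℤ) →* Kˣ :=
    (zpowersHom _ (Units.mk0 (2 : K) two_ne_zero)).comp
      (Pi.evalAddMonoidHom (fun _ : Fin n => ℤ) i).toMultiplicative
  obtain ⟨t, ht⟩ := exists_hom_torus (W := 𝟙_ (Over (Spec (.of K))))
    ((scalar (𝟙_ (Over (Spec (.of K)))) : _ →* _).comp ((Units.coeHom K).comp χ))
  refine ⟨t, fun h => hi ?_⟩
  rw [ht] at h
  have : Nontrivial Γ((𝟙_ (Over (Spec (.of K)))).left, ⊤) :=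
    (Scheme.ΓSpecIso (.of K)).symm.commRingCatIsoToRingEquiv.injective.nontrivial
  have h1 : (2 : K) ^ l i = 1 := by
    refine (scalar (𝟙_ (Over (Spec (.of K))))).injective ?_
    rw [map_one, ← h]
    simp [χ]
  -- Descending to the ordered field `ℚ` shows that `2` is not a root of unity.
  have h2 : (2 : ℚ) ^ l i = 1 := by
    refine Rat.cast_injective (α := K) ?_
    rw [Rat.cast_zpow, Rat.cast_ofNat, h1, Rat.cast_one]
  exact (zpow_eq_one_iff_right₀ (by norm_num) (by norm_num)).mp h2

end
end AffineToric

/-! ### Disconnectedness of the automorphism group -/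

open AffineToric in
theorem proposition1 {K : Type*} [Field K] [IsAlgClosed K] [CharZero K]
    (X : Over (Spec (.of K))) (hX : IsAffine X.left) (n : ℕ)
    (hT : AffineToric.ToricStructure n X)
    (hdeg : ¬ AffineToric.IsNondegenerate X) :
    ¬ AffineToric.IsConnectedSubgroup (⊤ : Subgroup (Aut X)) := by
  intro hconn
  obtain ⟨l, v, h, hv, hl⟩ := hT.exists_isUnit_pull_eq_character hdeg
  obtain ⟨g, hg⟩ := hT.exists_aut_inv hv hl
  obtain ⟨S, φ, hS, hSaff, ⟨F, hF⟩, -, ⟨s₁, hs₁⟩, ⟨s₀, hs₀⟩⟩ := hconn g trivial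
  have := hS.isIntegral
  obtain ⟨m, b, hmb⟩ := exists_pull_lift_eq_mul_character hT.incl F h.isUnit
  have h₀ (t : Pt (torus K n)) :
      pull s₀ b * pull t (character K m) = pull t (character K l) := by
    rw [← hmb, hF, hs₀, Category.assoc, pull_comp_apply, ← hl]
    exact congrArg (fun k => pull t (pull k _)) (Category.comp_id _)
  have h₁ (t : Pt (torus K n)) :
      pull s₁ b * pull t (character K m) = pull t (character K (-l)) := by
    rw [← hmb, hF, hs₁, Category.assoc, pull_comp_apply, hg]
  -- At the identity point `o` all characters are `1`, so `b` takes the value `1` at both `s₀` and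
  -- `s₁`.
  obtain ⟨o, ho⟩ := exists_hom_torus (K := K) (n := n) (W := 𝟙_ (Over (Spec (.of K)))) 1
  replace ho (k : Fin n → ℤ) : pull o (character K k) = 1 := ho k
  have hb₀ := h₀ o
  have hb₁ := h₁ o
  rw [ho, ho, mul_one] at hb₀ hb₁
  have hl0 : l ≠ 0 := by
    rintro rfl
    simp at hv
  obtain ⟨t, ht⟩ := exists_pt_pull_character_ne_one (K := K) (l := l + l) fun h2 =>
    hl0 (self_eq_neg.mp (eq_neg_of_add_eq_zero_left h2))
  refine ht ?_
  have h2 := (h₀ t).symm.trans (by rw [hb₀, ← hb₁, h₁ t])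
  rw [character_add, map_mul]
  nth_rw 2 [h2]
  rw [← map_mul, ← character_add, add_neg_cancel, character_zero, map_one]
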